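/- Let $G=(V,E)$ be a finite simple graph with input set $I\subseteq V$ and output set $O\subseteq V$, and write $A^c=V\setminus A$, $N(v)$ and $N[v]=N(v)\cup\{v\}$ for the open and closed neighbourhoods. Let $(f,\succ)$ be a flow of $(G,I,O)$: a map $f:O^c\to I^c$ and a strict partial order $\succ$ on $V$ such that for all $j\in O^c$: $f(j)$ is adjacent to $j$; $f(j)\succ j$; and $k\succ j$ for all $k\in N(f(j))\setminus\{j\}$. Let $>$ be a total order on $V$ that extends $\succ$, let $\phi_i\in\mathbb R$ ($i\in O^c$) be measurement angles, and write $|{\pm_\theta}\rangle=(|0\rangle\pm e^{i\theta}|1\rangle)/\sqrt2$, $|+\rangle=|+_0\rangle$; outcomes $0,1$ of a measurement in the basis $|\pm_\theta\rangle$ belong to $|+_\theta\rangle,|-_\theta\rangle$. **Standard 1WQC.** The qubits of $I$ carry the input. Prepare all qubits of $I^c$ in $|+\rangle$, apply CPHASE on all edges of $G$, then, for the vertices $i\in O^c$ in any order compatible with $\succ$, measure $i$ in the basis $|\pm_{\phi_i}\rangle$ with outcome $s_i$ and apply $X_{f(i)}^{s_i}\prod_{k\in N(f(i))\setminus\{i\}}Z_k^{s_i}$.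 **Lazy 1WQC.** The qubits of $I$ carry the input. For all $i\in V$ in increasing order with respect to $>$: prepare the qubits of $A(i)=N[i]\setminus\bigl(I\cup\bigcup_{j<i}N[j]\bigr)$ in $|+\rangle$; apply CPHASE to $i$ and $k$ for all $k\in N(i)$ with $k>i$; if $i\in O^c$, measure $i$ in the basis $|\pm_{\phi_i'}\rangle$ with $\phi_i'=(-1)^{s_{f^{-1}(i)}}\phi_i+z(i)\pi$, with outcome $s_i$; if $i\in O$, apply $X_i^{s_{f^{-1}(i)}}Z_i^{z(i)}$. Here $z(i)=\bigoplus_{k\in O^c,\;k<i,\;i\in N(f(k))}s_k$, and $s_{f^{-1}(i)}=0$ if $i$ is not in the range of $f$. Then both schemes are executable (no command depends on an outcome that is not yet known, acts on a qubit that is not yet prepared or already measured, or prepares a qubit a second time), both end with exactly the qubits of $O$ after measuring exactly those of $O^c$, and they implement the same map: for every outcome vector $s\in\{0,1\}^{O^c}$ and every operator $\rho$ on the input space $(\mathbb C^2)^{\otimes I}$ (in particular every input state), the unnormalized output operators on $(\mathbb C^2)^{\otimes O}$ of the two schemes in the branch $s$ coincide. Consequently the total maps $\mathcal E(\rho)$,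 the sums over all branches, coincide as well. -/

import Mathlib

open scoped Matrix

noncomputable section

namespace OneWay

/-! ### Qubit registers -/

section Registers

variable {V : Type*} [DecidableEq V]

/-- Labels of the computational basis of the qubits in `S`. -/
abbrev Basis (S : Finset V) : Type _ := {v // v ∈ S} → Fin 2

/-- Linear operators on the Hilbert space of the qubits in `S` (density operators included). -/
abbrev Op (S : Finset V) : Type _ := Matrix (Basis S) (Basis S) ℂ

/-- The state `|+_θ⟩ = (|0⟩ + e^{iθ} |1⟩) / √2`. -/
def ketPlus (θ : ℝ) : Fin 2 → ℂ :=
  ![1 / (Real.sqrt 2 : ℂ), Complex.exp (Complex.I * θ) / (Real.sqrt 2 : ℂ)]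

/-- Pauli `X`. -/
def pauliX : Matrix (Fin 2) (Fin 2) ℂ := !![0, 1; 1, 0]

/-- Pauli `Z`. -/
def pauliZ : Matrix (Fin 2) (Fin 2) ℂ := !![1, 0; 0, -1]

/-- The one-qubit operator `U` acting on qubit `j`, the identity acting on the other qubits. -/
def onQubit {S : Finset V} (j : {v // v ∈ S}) (U : Matrix (Fin 2) (Fin 2) ℂ) : Op S :=
  fun x y => if ∀ k, k ≠ j → x k = y k then U (x j) (y j) else 0

/-- The CPHASE gate on qubits `i` and `j`. -/
def cphase {S : Finset V} (i j : {v // v ∈ S}) : Op S :=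
  Matrix.diagonal fun x => if x i = 1 ∧ x j = 1 then -1 else 1

/-- The isometry `ψ ↦ ψ ⊗ |+⟩_j` adding the qubit `j` to the register `S`. -/
def prepKraus (S : Finset V) (j : V) : Matrix (Basis (insert j S)) (Basis S) ℂ :=
  fun x y =>
    if ∀ k : {v // v ∈ S}, x ⟨k, Finset.mem_insert_of_mem k.2⟩ = y k
    then ketPlus 0 (x ⟨j, Finset.mem_insert_self j S⟩) else 0

/-- The operator `⟨+_θ|_j`, which projects the qubit `j` on `|+_θ⟩` and discards it. -/
def braKraus {S : Finset V} (j : {v // v ∈ S}) (θ : ℝ) :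
    Matrix (Basis (S.erase j)) (Basis S) ℂ :=
  fun x y =>
    if ∀ k : {v // v ∈ S.erase (j : V)}, y ⟨k, Finset.mem_of_mem_erase k.2⟩ = x k
    then star (ketPlus θ (y j)) else 0

end Registers

/-! ### Measurement patterns -/

/-- The commands of the measurement calculus. A finite set `D` of qubits stands for the signal
`⨁_{k ∈ D} s_k`, where `s_k` is the outcome of the measurement of `k`. -/
inductive Cmd (V : Type*) where
  /-- `N_j^0`: prepare the qubit `j` in the state `|+⟩`. -/
  | prep (j : V)
  /-- `E_{ij}`: apply CPHASE to `i` and `j`. -/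
  | entangle (i j : V)
  /-- Measure `j` in the basis `|±_{θ'}⟩`, where `θ' = (-1)^{s_D} θ + s_{D'} π`. -/
  | measure (j : V) (θ : ℝ) (D D' : Finset V)
  /-- `X_j^{s_D}`. -/
  | corrX (j : V) (D : Finset V)
  /-- `Z_j^{s_D}`. -/
  | corrZ (j : V) (D : Finset V)

/-- A pattern is a list of commands, the first one in the list being executed first. -/
abbrev Pattern (V : Type*) := List (Cmd V)

/-- A configuration: the qubits that currently exist, the qubits that have been measured already,
and the (unnormalized) state of the existing qubits. -/
structure Config (V : Type*) [DecidableEq V] where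
  live : Finset V
  done : Finset V
  op : Op live

section Semantics

variable {V : Type*} [DecidableEq V]

/-- The value of the signal `⨁_{k ∈ D} s_k`. -/
def signal (s : V → ZMod 2) (D : Finset V) : ZMod 2 := ∑ k ∈ D, s k

/-- One command, in the branch of the computation with measurement outcomes `s`. The outcome `0`
of a measurement with angle `θ'` belongs to `|+_{θ'}⟩`, the outcome `1` to `|+_{θ'+π}⟩`.
The result is `none` if the command is not executable: it depends on an outcome that is not
known yet, acts on a qubit that does not exist (any more), or prepares a qubit again. -/
def step (s : V → ZMod 2) (c : Config V) : Cmd V → Option (Config V)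
  | .prep j =>
      if j ∉ c.live ∧ j ∉ c.done then
        some ⟨insert j c.live, c.done,
          prepKraus c.live j * c.op * (prepKraus c.live j)ᴴ⟩
      else none
  | .entangle i j =>
      if h : i ∈ c.live ∧ j ∈ c.live ∧ i ≠ j then
        some ⟨c.live, c.done,
          cphase ⟨i, h.1⟩ ⟨j, h.2.1⟩ * c.op * (cphase ⟨i, h.1⟩ ⟨j, h.2.1⟩)ᴴ⟩
      else none
  | .measure j θ D D' =>
      if h : j ∈ c.live ∧ D ⊆ c.done ∧ D' ⊆ c.done then
        let θ' : ℝ := (-1) ^ (signal s D).val * θ + (signal s D').val * Real.pi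
        let K := braKraus ⟨j, h.1⟩ (θ' + (s j).val * Real.pi)
        some ⟨c.live.erase j, insert j c.done, K * c.op * Kᴴ⟩
      else none
  | .corrX j D =>
      if h : j ∈ c.live ∧ D ⊆ c.done then
        let U := onQubit ⟨j, h.1⟩ (pauliX ^ (signal s D).val)
        some ⟨c.live, c.done, U * c.op * Uᴴ⟩
      else none
  | .corrZ j D =>
      if h : j ∈ c.live ∧ D ⊆ c.done then
        let U := onQubit ⟨j, h.1⟩ (pauliZ ^ (signal s D).val)
        some ⟨c.live, c.done, U * c.op * Uᴴ⟩
      else none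

/-- Execute a pattern in the branch with measurement outcomes `s`. -/
def run (s : V → ZMod 2) : Pattern V → Config V → Option (Config V)
  | [], c => some c
  | a :: P, c => (step s c a).bind (run s P)

/-- Outcomes for the measured qubits `Oᶜ` as a function on `V` (the values on `O` play no role). -/
def extendOutcomes (O : Finset V) (s : {v // v ∉ O} → ZMod 2) (v : V) : ZMod 2 :=
  if h : v ∉ O then s ⟨v, h⟩ else 0

variable [Fintype V]

/-- With inputs `I` and outputs `O`, the pattern `P` is executable in all branches, it measures
exactly the qubits of `Oᶜ`, and in the branch with outcomes `s` it maps the input operator `ρ` to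
the unnormalized output `K s ρ` (its trace is the probability of the branch if `ρ` is a state). -/
def Realizes (P : Pattern V) (I O : Finset V)
    (K : ({v // v ∉ O} → ZMod 2) → (Op I →ₗ[ℂ] Op O)) : Prop :=
  ∀ (s : {v // v ∉ O} → ZMod 2) (ρ : Op I),
    run (extendOutcomes O s) P ⟨I, ∅, ρ⟩ = some ⟨O, Oᶜ, K s ρ⟩

/-- The pattern `P` implements the map `𝓔`, the sum of the maps of all its branches. -/
def Implements (P : Pattern V) (I O : Finset V) (𝓔 : Op I →ₗ[ℂ] Op O) : Prop :=
  ∃ K : ({v // v ∉ O} → ZMod 2) → (Op I →ₗ[ℂ] Op O), Realizes P I O K ∧ 𝓔 = ∑ s, K s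

end Semantics

/-! ### Flow and the two schemes -/

/-- `(f, ≺)` is a flow of the open graph `(G, I, O)`. -/
structure IsFlow {V : Type*} (G : SimpleGraph V) (I O : Finset V)
    (f : {v // v ∉ O} → {v // v ∉ I}) (prec : V → V → Prop) : Prop where
  order : IsStrictOrder V prec
  f0 : ∀ j : {v // v ∉ O}, G.Adj j (f j)
  f1 : ∀ j : {v // v ∉ O}, prec j (f j)
  f2 : ∀ j : {v // v ∉ O}, ∀ k, G.Adj (f j) k → k ≠ j → prec j k

section Schemes

variable {V : Type*} [Fintype V] [LinearOrder V] (G : SimpleGraph V) [DecidableRel G.Adj]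
  (I O : Finset V)

/-- The closed neighbourhood `N[i]`. -/
def closedNbhd (i : V) : Finset V := insert i (G.neighborFinset i)

/-- `A(i) = N[i] \ (I ∪ ⋃_{j < i} N[j])`. -/
def fresh (i : V) : Finset V :=
  closedNbhd G i \ (I ∪ (Finset.univ.filter (· < i)).biUnion (closedNbhd G))

variable {I O} (f : {v // v ∉ O} → {v // v ∉ I}) (φ : {v // v ∉ O} → ℝ)

/-- The qubits with signal `s_{f⁻¹(i)}`: the set `{f⁻¹(i)}` (a flow is injective), which is empty,
so that the signal is `0`, if `i` is not in the range of `f`. -/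
def xDep (i : V) : Finset V :=
  (Finset.univ.filter fun k : {v // v ∉ O} => (f k : V) = i).image Subtype.val

/-- The qubits with signal `z(i) = ⨁_{k < i, i ∈ N(f(k))} s_k`. -/
def zDep (i : V) : Finset V :=
  (Finset.univ.filter fun k : {v // v ∉ O} => (k : V) < i ∧ G.Adj (f k) i).image Subtype.val

/-- The body of the loop of lazy 1WQC, for the vertex `i`. -/
def lazyRound (i : V) : Pattern V :=
  (fresh G I i).toList.map Cmd.prep
    ++ ((G.neighborFinset i).filter (i < ·)).toList.map (Cmd.entangle i)
    ++ if h : i ∉ O then [Cmd.measure i (φ ⟨i, h⟩) (xDep f i) (zDep G f i)]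
       else [Cmd.corrZ i (zDep G f i), Cmd.corrX i (xDep f i)]

/-- Lazy 1WQC: run through all vertices in increasing order. -/
def lazyPattern : Pattern V :=
  (Finset.univ.sort (· ≤ ·) : List V).flatMap (lazyRound G f φ)

/-- Standard 1WQC: prepare all the qubits of `Iᶜ`, apply `E_G`, then measure the qubits of `Oᶜ`
in the order of the list `L`, following the measurement of `i` with outcome `s_i` by the
corrections `X_{f(i)}^{s_i} ∏_{k ∈ N(f(i)) \ {i}} Z_k^{s_i}`. -/
def standardPattern (L : List {v // v ∉ O}) : Pattern V :=
  (Iᶜ).toList.map Cmd.prep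
    ++ ((Finset.univ.filter fun e : V × V => e.1 < e.2 ∧ G.Adj e.1 e.2).toList.map
          fun e => Cmd.entangle e.1 e.2)
    ++ L.flatMap fun i : {v // v ∉ O} =>
        Cmd.measure (i : V) (φ i) ∅ ∅
          :: (((G.neighborFinset (f i : V)).erase (i : V)).toList.map fun k => Cmd.corrZ k {(i : V)})
          ++ [Cmd.corrX (f i : V) {(i : V)}]

end Schemes

end OneWay

end

/-! The two schemes have the same normal form. In a fixed branch, the state after each command of
the simulated runs is written as a network: the matrix entries of the graph state built from the
input (`graphEntries`: a factor 1/2 for each prepared qubit, a sign for each CPHASE, and the entry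
of `ρ`), followed by one superoperator `κ v` at each vertex. A row and a column label are attached
to every vertex of `V`, so that registers of different sizes use the same kind of function.

Lazy 1WQC entangles after it has already measured or corrected other qubits. A CPHASE factor
nevertheless moves inside the network, because `κ` is still the identity at both ends of the edge
(`network_mul`). Preparing late is harmless because the network does not depend on the label of an
untouched vertex (`network_update`). Hence all preparations and CPHASEs can be thought of as done
first, and each vertex then receives `finalSite`.

Standard 1WQC accumulates conjugations by `X^x Z^z` at each vertex. A measurement absorbs them: `X`
negates the angle, and `Z` shifts it by `π` (`measMatrix_mul_pauliMatrix`). The flow conditions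
place every correction caused by `j` at a vertex above `j`, so a vertex has received all its
corrections when it is measured. Its exponents are therefore the full signals
(`exponentX_eq_signal`, `exponentZ_eq_signal`), and the result is again `finalSite`. -/

open scoped Matrix

noncomputable section

namespace OneWay

/-! ### Commands as operations on matrix entries -/

section Networks

variable {V : Type*} [DecidableEq V]

/-- The labelling of all vertices that agrees with the labels `x` (of the rows) and `y` (of the
columns) on `S`, and vanishes elsewhere. -/
def joinLabels (S : Finset V) (x y : Basis S) (v : V) : Fin 2 × Fin 2 :=
  if h : v ∈ S then (x ⟨v, h⟩, y ⟨v, h⟩) else (0, 0)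

/-- The operator on the qubits in `S` with the matrix entries given by `T`. -/
def opOf (S : Finset V) (T : (V → Fin 2 × Fin 2) → ℂ) : Op S :=
  fun x y => T (joinLabels S x y)

/-- The configuration whose operator has the matrix entries given by `T`. -/
def cfgOf (S D : Finset V) (T : (V → Fin 2 × Fin 2) → ℂ) : Config V :=
  ⟨S, D, opOf S T⟩

/-- The superoperator with matrix `A` acting on the vertex `j`. -/
def siteOp (j : V) (A : Matrix (Fin 2 × Fin 2) (Fin 2 × Fin 2) ℂ)
    (T : (V → Fin 2 × Fin 2) → ℂ) (u : V → Fin 2 × Fin 2) : ℂ :=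
  ∑ q, A (u j) q * T (Function.update u j q)

/-- The matrix of the superoperator `ρ ↦ U ρ U†` of one qubit. -/
def conjMatrix (U : Matrix (Fin 2) (Fin 2) ℂ) : Matrix (Fin 2 × Fin 2) (Fin 2 × Fin 2) ℂ :=
  fun p q => U p.1 q.1 * star (U p.2 q.2)

/-- The matrix of the superoperator `ρ ↦ ⟨+_θ| ρ |+_θ⟩` of one qubit. -/
def measMatrix (θ : ℝ) : Matrix (Fin 2 × Fin 2) (Fin 2 × Fin 2) ℂ :=
  fun _ q => star (ketPlus θ q.1) * ketPlus θ q.2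

/-- The sign that the CPHASE gate gives to a basis vector. -/
def cphaseSign (a b : Fin 2) : ℂ := if a = 1 ∧ b = 1 then -1 else 1

lemma star_cphaseSign (a b : Fin 2) : star (cphaseSign a b) = cphaseSign a b := by
  unfold cphaseSign; split_ifs <;> simp

lemma onQubit_mul_apply {S : Finset V} {n : Type*} (j : {v // v ∈ S})
    (U : Matrix (Fin 2) (Fin 2) ℂ) (M : Matrix (Basis S) n ℂ) (x : Basis S) (y : n) :
    (onQubit j U * M) x y = ∑ a, U (x j) a * M (Function.update x j a) y := by
  simp only [Matrix.mul_apply, onQubit, ite_mul, zero_mul]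
  rw [← Finset.sum_filter]
  symm
  refine Finset.sum_bij' (fun a _ => Function.update x j a) (fun z _ => z j) ?_ ?_ ?_ ?_ ?_
  · intro a _
    simp only [Finset.mem_filter, Finset.mem_univ, true_and]
    intro k hk
    simp [hk]
  · simp
  · simp
  · intro z hz
    simp only [Finset.mem_filter, Finset.mem_univ, true_and] at hz
    funext k
    by_cases hk : k = j
    · subst hk; simp
    · simp [hk, hz k hk]
  · simp

/-- Extend the labels `x` by the label `a` for the vertex `j`. -/
def extendLabel {S : Finset V} (j : V) (x : Basis (S.erase j)) (a : Fin 2) : Basis S :=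
  fun v => if h : (v : V) = j then a else x ⟨v, Finset.mem_erase.2 ⟨h, v.2⟩⟩

lemma braKraus_mul_apply {S : Finset V} {n : Type*} (j : {v // v ∈ S}) (θ : ℝ)
    (M : Matrix (Basis S) n ℂ) (x : Basis (S.erase j)) (y : n) :
    (braKraus j θ * M) x y = ∑ a, star (ketPlus θ a) * M (extendLabel j x a) y := by
  simp only [Matrix.mul_apply, braKraus, ite_mul, zero_mul]
  rw [← Finset.sum_filter]
  symm
  refine Finset.sum_bij' (fun a _ => extendLabel j x a) (fun z _ => z j) ?_ ?_ ?_ ?_ ?_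
  · intro a _
    simp only [Finset.mem_filter, Finset.mem_univ, true_and]
    intro k
    simp [extendLabel, Finset.ne_of_mem_erase k.2]
  · simp
  · simp [extendLabel]
  · intro z hz
    simp only [Finset.mem_filter, Finset.mem_univ, true_and] at hz
    funext k
    by_cases hk : k = j
    · subst hk; simp [extendLabel]
    · have hk' : (k : V) ≠ j := fun h => hk (Subtype.ext h)
      simp [extendLabel, hk', ← hz]
  · simp [extendLabel]

lemma prepKraus_mul_apply {S : Finset V} {n : Type*} (j : V)
    (M : Matrix (Basis S) n ℂ) (x : Basis (insert j S)) (y : n) :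
    (prepKraus S j * M) x y =
      (1 / (Real.sqrt 2 : ℂ)) * M (fun k : {v // v ∈ S} => x ⟨k, Finset.mem_insert_of_mem k.2⟩)
        y := by
  have hket : ∀ a, ketPlus 0 a = 1 / (Real.sqrt 2 : ℂ) := by
    intro a; fin_cases a <;> simp [ketPlus]
  simp only [Matrix.mul_apply, prepKraus, ite_mul, zero_mul, hket]
  rw [Finset.sum_eq_single (fun k : {v // v ∈ S} => x ⟨k, Finset.mem_insert_of_mem k.2⟩)]
  · simp
  · intro z _ hz
    rw [if_neg]
    intro h
    exact hz (funext fun k => (h k).symm)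
  · simp

/-- Conjugation is two left multiplications with an adjoint in between, so the formulas for
multiplying by a Kraus operator on the left suffice for both sides. -/
lemma mul_mul_conjTranspose_apply {m n : Type*} [Fintype m] [Fintype n] (K : Matrix m n ℂ)
    (A : Matrix n n ℂ) (x y : m) :
    (K * A * Kᴴ) x y = star ((K * (K * A)ᴴ) y x) := by
  rw [← Matrix.conjTranspose_apply, Matrix.conjTranspose_mul, Matrix.conjTranspose_conjTranspose]

lemma update_joinLabels {S : Finset V} (j : {v // v ∈ S}) (x y : Basis S) (a b : Fin 2) :
    Function.update (joinLabels S x y) j (a, b) =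
      joinLabels S (Function.update x j a) (Function.update y j b) := by
  funext v
  by_cases hv : v = j
  · subst hv; simp [joinLabels]
  · by_cases hS : v ∈ S
    · have : (⟨v, hS⟩ : {v // v ∈ S}) ≠ j := fun h => hv (congrArg Subtype.val h)
      simp [joinLabels, hv, hS, this]
    · simp [joinLabels, hv, hS]

lemma update_joinLabels_erase {S : Finset V} (j : {v // v ∈ S}) (x y : Basis (S.erase j))
    (a b : Fin 2) :
    Function.update (joinLabels (S.erase j) x y) j (a, b) =
      joinLabels S (extendLabel j x a) (extendLabel j y b) := by
  funext v
  by_cases hv : v = j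
  · subst hv; simp [joinLabels, extendLabel]
  · by_cases hS : v ∈ S
    · simp [joinLabels, hv, hS, extendLabel]
    · simp [joinLabels, hv, hS]

lemma onQubit_conj_apply {S : Finset V} (j : {v // v ∈ S}) (U : Matrix (Fin 2) (Fin 2) ℂ)
    (T : (V → Fin 2 × Fin 2) → ℂ) (x y : Basis S) :
    (onQubit j U * opOf S T * (onQubit j U)ᴴ) x y =
      siteOp (j : V) (conjMatrix U) T (joinLabels S x y) := by
  rw [mul_mul_conjTranspose_apply, onQubit_mul_apply]
  simp only [Matrix.conjTranspose_apply, onQubit_mul_apply, siteOp, Fintype.sum_prod_type,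
    update_joinLabels, conjMatrix, star_sum, star_mul', star_star, Finset.mul_sum]
  rw [Finset.sum_comm]
  refine Finset.sum_congr rfl fun a _ => Finset.sum_congr rfl fun b _ => ?_
  simp only [opOf, joinLabels, j.2, dif_pos]
  ring

lemma braKraus_conj_apply {S : Finset V} (j : {v // v ∈ S}) (θ : ℝ)
    (T : (V → Fin 2 × Fin 2) → ℂ) (x y : Basis (S.erase j)) :
    (braKraus j θ * opOf S T * (braKraus j θ)ᴴ) x y =
      siteOp (j : V) (measMatrix θ) T (joinLabels (S.erase j) x y) := by
  rw [mul_mul_conjTranspose_apply, braKraus_mul_apply]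
  simp only [Matrix.conjTranspose_apply, braKraus_mul_apply, siteOp, Fintype.sum_prod_type,
    update_joinLabels_erase, measMatrix, star_sum, star_mul', star_star, Finset.mul_sum]
  rw [Finset.sum_comm]
  refine Finset.sum_congr rfl fun a _ => Finset.sum_congr rfl fun b _ => ?_
  simp only [opOf]
  ring

lemma step_measure (s : V → ZMod 2) {S D : Finset V} (T : (V → Fin 2 × Fin 2) → ℂ) {j : V}
    (θ : ℝ) {A B : Finset V} (hj : j ∈ S) (hA : A ⊆ D) (hB : B ⊆ D) :
    step s (cfgOf S D T) (.measure j θ A B) = some (cfgOf (S.erase j) (insert j D)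
      (siteOp j (measMatrix ((-1) ^ (signal s A).val * θ + (signal s B).val * Real.pi
        + (s j).val * Real.pi)) T)) := by
  have h : j ∈ (cfgOf S D T).live ∧ A ⊆ (cfgOf S D T).done ∧ B ⊆ (cfgOf S D T).done :=
    ⟨hj, hA, hB⟩
  rw [step, dif_pos h]
  refine congrArg some (congrArg (Config.mk _ _) ?_)
  ext x y
  exact braKraus_conj_apply ⟨j, hj⟩ _ T x y

lemma step_corrX (s : V → ZMod 2) {S D : Finset V} (T : (V → Fin 2 × Fin 2) → ℂ) {j : V}
    {A : Finset V} (hj : j ∈ S) (hA : A ⊆ D) :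
    step s (cfgOf S D T) (.corrX j A) = some (cfgOf S D
      (siteOp j (conjMatrix (pauliX ^ (signal s A).val)) T)) := by
  have h : j ∈ (cfgOf S D T).live ∧ A ⊆ (cfgOf S D T).done := ⟨hj, hA⟩
  rw [step, dif_pos h]
  refine congrArg some (congrArg (Config.mk _ _) ?_)
  ext x y
  exact onQubit_conj_apply ⟨j, hj⟩ _ T x y

lemma step_corrZ (s : V → ZMod 2) {S D : Finset V} (T : (V → Fin 2 × Fin 2) → ℂ) {j : V}
    {A : Finset V} (hj : j ∈ S) (hA : A ⊆ D) :
    step s (cfgOf S D T) (.corrZ j A) = some (cfgOf S D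
      (siteOp j (conjMatrix (pauliZ ^ (signal s A).val)) T)) := by
  have h : j ∈ (cfgOf S D T).live ∧ A ⊆ (cfgOf S D T).done := ⟨hj, hA⟩
  rw [step, dif_pos h]
  refine congrArg some (congrArg (Config.mk _ _) ?_)
  ext x y
  exact onQubit_conj_apply ⟨j, hj⟩ _ T x y

/-- The sign that CPHASE on `i` and `j` gives to a matrix entry. -/
def edgeSign (i j : V) (u : V → Fin 2 × Fin 2) : ℂ :=
  cphaseSign (u i).1 (u j).1 * cphaseSign (u i).2 (u j).2

lemma cphase_conj_apply {S : Finset V} (i j : {v // v ∈ S}) (T : (V → Fin 2 × Fin 2) → ℂ)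
    (x y : Basis S) :
    (cphase i j * opOf S T * (cphase i j)ᴴ) x y =
      edgeSign (i : V) j (joinLabels S x y) * T (joinLabels S x y) := by
  have hdiag : cphase i j = Matrix.diagonal fun z : Basis S => cphaseSign (z i) (z j) := rfl
  rw [hdiag, Matrix.diagonal_conjTranspose, Matrix.mul_diagonal, Matrix.diagonal_mul,
    Pi.star_apply, star_cphaseSign]
  simp only [opOf, edgeSign, joinLabels, i.2, j.2, dif_pos]
  ring

/-- The factor 1/2 comes from the amplitude `1/√2` on the row and on the column. Before the
preparation `j` carries the default label `(0, 0)`, afterwards an arbitrary one; `hT` makes the two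
readings of `T` agree. -/
lemma prepKraus_conj_apply {S : Finset V} {j : V} (hS : j ∉ S) (T : (V → Fin 2 × Fin 2) → ℂ)
    (hT : ∀ u q, T (Function.update u j q) = T u) (x y : Basis (insert j S)) :
    (prepKraus S j * opOf S T * (prepKraus S j)ᴴ) x y =
      1 / 2 * T (joinLabels (insert j S) x y) := by
  rw [mul_mul_conjTranspose_apply, prepKraus_mul_apply, Matrix.conjTranspose_apply,
    prepKraus_mul_apply]
  have hlab : joinLabels S (fun k => x ⟨k, Finset.mem_insert_of_mem k.2⟩)
      (fun k => y ⟨k, Finset.mem_insert_of_mem k.2⟩) =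
      Function.update (joinLabels (insert j S) x y) j (0, 0) := by
    funext v
    by_cases hv : v = j
    · subst hv; simp [joinLabels, hS]
    · by_cases hvS : v ∈ S <;> simp [joinLabels, hv, hvS]
  have hsq : (1 / (Real.sqrt 2 : ℂ)) * (1 / (Real.sqrt 2 : ℂ)) = 1 / 2 := by
    rw [div_mul_div_comm, ← Complex.ofReal_mul, Real.mul_self_sqrt (by norm_num)]
    norm_num
  have hstar : star (1 / (Real.sqrt 2 : ℂ)) = 1 / (Real.sqrt 2 : ℂ) := by simp
  simp only [star_mul', star_star, hstar]
  rw [← mul_assoc, hsq, opOf, hlab, hT]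

lemma step_entangle (s : V → ZMod 2) {S D : Finset V} (T : (V → Fin 2 × Fin 2) → ℂ) {i j : V}
    (hi : i ∈ S) (hj : j ∈ S) (hij : i ≠ j) :
    step s (cfgOf S D T) (.entangle i j) =
      some (cfgOf S D fun u => edgeSign i j u * T u) := by
  have h : i ∈ (cfgOf S D T).live ∧ j ∈ (cfgOf S D T).live ∧ i ≠ j := ⟨hi, hj, hij⟩
  rw [step, dif_pos h]
  refine congrArg some (congrArg (Config.mk _ _) ?_)
  ext x y
  exact cphase_conj_apply ⟨i, hi⟩ ⟨j, hj⟩ T x y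

lemma step_prep (s : V → ZMod 2) {S D : Finset V} (T : (V → Fin 2 × Fin 2) → ℂ) {j : V}
    (hS : j ∉ S) (hD : j ∉ D) (hT : ∀ u q, T (Function.update u j q) = T u) :
    step s (cfgOf S D T) (.prep j) = some (cfgOf (insert j S) D fun u => 1 / 2 * T u) := by
  have h : j ∉ (cfgOf S D T).live ∧ j ∉ (cfgOf S D T).done := ⟨hS, hD⟩
  rw [step, if_pos h]
  refine congrArg some (congrArg (Config.mk _ _) ?_)
  ext x y
  exact prepKraus_conj_apply hS T hT x y

end Networks

/-! ### Pauli conjugations and their absorption by measurements -/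

section SiteMatrices

lemma conjMatrix_mul (U W : Matrix (Fin 2) (Fin 2) ℂ) :
    conjMatrix (U * W) = conjMatrix U * conjMatrix W := by
  ext p q
  simp only [conjMatrix, Matrix.mul_apply, Fintype.sum_prod_type, star_sum, star_mul',
    Finset.sum_mul_sum]
  refine Finset.sum_congr rfl fun a _ => Finset.sum_congr rfl fun b _ => ?_
  ring

lemma conjMatrix_one : conjMatrix 1 = 1 := by
  ext p q
  obtain ⟨a, b⟩ := p
  obtain ⟨c, d⟩ := q
  by_cases h : a = c <;> by_cases h' : b = d <;> simp [conjMatrix, Matrix.one_apply, h, h']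

/-- The matrix of conjugation with `X^x Z^z`. -/
def pauliMatrix (x z : ZMod 2) : Matrix (Fin 2 × Fin 2) (Fin 2 × Fin 2) ℂ :=
  conjMatrix (pauliX ^ x.val) * conjMatrix (pauliZ ^ z.val)

lemma pauliMatrix_zero : pauliMatrix 0 0 = 1 := by
  simp [pauliMatrix, conjMatrix_one]

lemma pauliX_sq : pauliX * pauliX = 1 := by
  ext i j; fin_cases i <;> fin_cases j <;> simp [pauliX]

lemma pauliZ_sq : pauliZ * pauliZ = 1 := by
  ext i j; fin_cases i <;> fin_cases j <;> simp [pauliZ]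

lemma pow_val_add {M : Type*} [Monoid M] {m : M} (hm : m * m = 1) (a b : ZMod 2) :
    m ^ (a + b).val = m ^ a.val * m ^ b.val := by
  rw [← pow_add, ZMod.val_add, ← pow_eq_pow_mod _ (by rw [pow_two, hm])]

/-- `X` and `Z` anticommute, but the sign occurs once on the row and once on the column and cancels.
-/
lemma conjMatrix_pauli_comm :
    conjMatrix pauliZ * conjMatrix pauliX = conjMatrix pauliX * conjMatrix pauliZ := by
  rw [← conjMatrix_mul, ← conjMatrix_mul]
  ext ⟨a, b⟩ ⟨c, d⟩
  fin_cases a <;> fin_cases b <;> fin_cases c <;> fin_cases d <;>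
    simp [conjMatrix, pauliX, pauliZ]

lemma conjMatrix_pow (U : Matrix (Fin 2) (Fin 2) ℂ) (n : ℕ) :
    conjMatrix (U ^ n) = conjMatrix U ^ n := by
  induction n with
  | zero => simp [conjMatrix_one]
  | succ n ih => rw [pow_succ, conjMatrix_mul, ih, pow_succ]

lemma conjMatrix_pauliX_mul_pauliMatrix (t x z : ZMod 2) :
    conjMatrix (pauliX ^ t.val) * pauliMatrix x z = pauliMatrix (x + t) z := by
  rw [pauliMatrix, pauliMatrix, ← mul_assoc, ← conjMatrix_mul, ← pow_val_add pauliX_sq,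
    add_comm x t]

lemma conjMatrix_pauliZ_mul_pauliMatrix (t x z : ZMod 2) :
    conjMatrix (pauliZ ^ t.val) * pauliMatrix x z = pauliMatrix x (z + t) := by
  have h : Commute (conjMatrix (pauliZ ^ t.val)) (conjMatrix (pauliX ^ x.val)) := by
    rw [conjMatrix_pow, conjMatrix_pow]
    exact (show Commute _ _ from conjMatrix_pauli_comm).pow_pow _ _
  rw [pauliMatrix, pauliMatrix, ← mul_assoc, h.eq, mul_assoc, ← conjMatrix_mul,
    ← pow_val_add pauliZ_sq, add_comm z t]

/-- In this form only the difference of column and row label matters: flipping both labels negates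
it, and a sign for each label is a shift of `θ` by `π`. -/
lemma measMatrix_apply (θ : ℝ) (p q : Fin 2 × Fin 2) :
    measMatrix θ p q =
      1 / 2 * Complex.exp (Complex.I * (((q.2 : ℕ) : ℂ) - ((q.1 : ℕ) : ℂ)) * θ) := by
  have hsq : (Real.sqrt 2 : ℂ) * (Real.sqrt 2 : ℂ) = 2 := by
    rw [← Complex.ofReal_mul, Real.mul_self_sqrt (by norm_num)]
    norm_num
  have hne : (Real.sqrt 2 : ℂ) ≠ 0 := by
    intro h; rw [h] at hsq; norm_num at hsq
  have hexp : (starRingEnd ℂ) (Complex.exp (Complex.I * θ)) = Complex.exp (-(Complex.I * θ)) := by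
    rw [← Complex.exp_conj]; simp
  have hinv : Complex.exp (-(Complex.I * θ)) * Complex.exp (Complex.I * θ) = 1 := by
    rw [← Complex.exp_add]; simp
  obtain ⟨a, b⟩ := q
  fin_cases a <;> fin_cases b <;> simp [measMatrix, ketPlus, hexp] <;> field_simp <;>
    simp [pow_two, hsq, hinv]

lemma measMatrix_add_two_pi (θ : ℝ) : measMatrix (θ + 2 * Real.pi) = measMatrix θ := by
  have h : ∀ a, ketPlus (θ + 2 * Real.pi) a = ketPlus θ a := by
    intro a
    have : Complex.I * ((θ : ℂ) + 2 * Real.pi) = Complex.I * θ + 2 * Real.pi * Complex.I := by ring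
    fin_cases a <;> simp [ketPlus, this, Complex.exp_periodic _]
  funext p q
  simp only [measMatrix, h]

lemma measMatrix_mul_conj_pauliX (θ : ℝ) :
    measMatrix θ * conjMatrix pauliX = measMatrix (-θ) := by
  ext p ⟨a, b⟩
  rw [Matrix.mul_apply]
  simp only [measMatrix_apply, Fintype.sum_prod_type]
  fin_cases a <;> fin_cases b <;> simp [conjMatrix, pauliX]

lemma measMatrix_mul_conj_pauliZ (θ : ℝ) :
    measMatrix θ * conjMatrix pauliZ = measMatrix (θ + Real.pi) := by
  have h1 : Complex.exp (Complex.I * (θ + Real.pi)) = - Complex.exp (Complex.I * θ) := by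
    rw [mul_add, Complex.exp_add, mul_comm _ (Real.pi : ℂ), Complex.exp_pi_mul_I]; ring
  have h2 : Complex.exp (-(Complex.I * (θ + Real.pi))) = - Complex.exp (-(Complex.I * θ)) := by
    rw [Complex.exp_neg, h1, Complex.exp_neg, inv_neg]
  ext p ⟨a, b⟩
  rw [Matrix.mul_apply]
  simp only [measMatrix_apply, Fintype.sum_prod_type]
  fin_cases a <;> fin_cases b <;> simp [conjMatrix, pauliZ, h1, h2]

lemma measMatrix_mul_pauliMatrix (φ : ℝ) (x z t : ZMod 2) :
    measMatrix (φ + t.val * Real.pi) * pauliMatrix x z =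
      measMatrix ((-1) ^ x.val * φ + z.val * Real.pi + t.val * Real.pi) := by
  have hX : measMatrix (φ + t.val * Real.pi) * conjMatrix (pauliX ^ x.val) =
      measMatrix ((-1) ^ x.val * φ + t.val * Real.pi) := by
    fin_cases x
    · simp [ZMod.val, conjMatrix_one]
    · fin_cases t
      · simp [ZMod.val, measMatrix_mul_conj_pauliX]
      · simp only [ZMod.val, pow_one, measMatrix_mul_conj_pauliX]
        -- `X` also negates the outcome shift `π`; a full turn brings `-π` back to `π`.
        rw [← measMatrix_add_two_pi]
        congr 1
        push_cast
        ring
  rw [pauliMatrix, ← mul_assoc, hX]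
  fin_cases z
  · simp [ZMod.val, conjMatrix_one]
  · simp only [ZMod.val, pow_one, measMatrix_mul_conj_pauliZ]
    congr 1
    push_cast
    ring

end SiteMatrices

/-! ### Networks of one-qubit superoperators -/

section TensorNetworks

variable {V : Type*} [DecidableEq V] [Fintype V]

/-- Apply the superoperators `κ v` to all the qubits `v` of the operator with entries `b`. -/
def network (κ : V → Matrix (Fin 2 × Fin 2) (Fin 2 × Fin 2) ℂ) (b : (V → Fin 2 × Fin 2) → ℂ)
    (u : V → Fin 2 × Fin 2) : ℂ :=
  ∑ w : V → Fin 2 × Fin 2, (∏ v, κ v (u v) (w v)) * b w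

lemma network_one (b : (V → Fin 2 × Fin 2) → ℂ) : network 1 b = b := by
  funext u
  rw [network, Finset.sum_eq_single u]
  · simp
  · intro w _ hw
    obtain ⟨v, hv⟩ := Function.ne_iff.1 hw
    rw [Finset.prod_eq_zero (Finset.mem_univ v), zero_mul]
    simp [hv.symm]
  · simp

lemma siteOp_network (j : V) (A : Matrix (Fin 2 × Fin 2) (Fin 2 × Fin 2) ℂ)
    (κ : V → Matrix (Fin 2 × Fin 2) (Fin 2 × Fin 2) ℂ) (b : (V → Fin 2 × Fin 2) → ℂ) :
    siteOp j A (network κ b) = network (Function.update κ j (A * κ j)) b := by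
  funext u
  simp only [siteOp, network, Finset.mul_sum]
  rw [Finset.sum_comm]
  refine Finset.sum_congr rfl fun w _ => ?_
  rw [← Finset.mul_prod_erase _ _ (Finset.mem_univ j), Function.update_self, Matrix.mul_apply,
    Finset.sum_mul, Finset.sum_mul]
  refine Finset.sum_congr rfl fun q _ => ?_
  rw [← Finset.mul_prod_erase _ _ (Finset.mem_univ j), Function.update_self]
  have : ∏ v ∈ Finset.univ.erase j, κ v (Function.update u j q v) (w v) =
      ∏ v ∈ Finset.univ.erase j, Function.update κ j (A * κ j) v (u v) (w v) :=
    Finset.prod_congr rfl fun v hv => by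
      rw [Function.update_of_ne (Finset.ne_of_mem_erase hv),
        Function.update_of_ne (Finset.ne_of_mem_erase hv)]
  rw [this]
  ring

/-- In a nonzero term, `w` agrees with `u` wherever `κ` is the identity, and `e` looks at no other
coordinates. This is what lets a CPHASE pass superoperators on other qubits. -/
lemma network_mul (κ : V → Matrix (Fin 2 × Fin 2) (Fin 2 × Fin 2) ℂ)
    (b e : (V → Fin 2 × Fin 2) → ℂ)
    (he : ∀ u w : V → Fin 2 × Fin 2, (∀ v, κ v = 1 → u v = w v) → e u = e w) :
    network κ (fun w => e w * b w) = fun u => e u * network κ b u := by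
  funext u
  simp only [network, Finset.mul_sum]
  refine Finset.sum_congr rfl fun w _ => ?_
  by_cases h : ∀ v, κ v = 1 → u v = w v
  · rw [he u w h]; ring
  · push Not at h
    obtain ⟨v, hv, hne⟩ := h
    have : ∏ v, κ v (u v) (w v) = 0 :=
      Finset.prod_eq_zero (Finset.mem_univ v) (by rw [hv, Matrix.one_apply_ne hne])
    rw [this]; ring

lemma network_update {κ : V → Matrix (Fin 2 × Fin 2) (Fin 2 × Fin 2) ℂ}
    {b : (V → Fin 2 × Fin 2) → ℂ} {j : V} (hκ : κ j = 1)
    (hb : ∀ u q, b (Function.update u j q) = b u) (u : V → Fin 2 × Fin 2) (q : Fin 2 × Fin 2) :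
    network κ b (Function.update u j q) = network κ b u := by
  -- Swapping the labels `u j` and `q` at `j` matches the terms of the two sums: `b` ignores this
  -- coordinate, and the identity at `j` merely pins it to `q` in one sum and to `u j` in the other.
  let σ : (V → Fin 2 × Fin 2) ≃ (V → Fin 2 × Fin 2) :=
    Equiv.piCongrRight fun v => if v = j then Equiv.swap (u j) q else Equiv.refl _
  have hσ : ∀ w, σ w = Function.update w j (Equiv.swap (u j) q (w j)) := by
    intro w; funext v
    by_cases hv : v = j
    · subst hv; simp [σ]
    · simp [σ, hv]
  rw [network, network, ← Equiv.sum_comp σ]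
  refine Finset.sum_congr rfl fun w _ => ?_
  rw [hσ, hb]
  congr 1
  refine Finset.prod_congr rfl fun v _ => ?_
  by_cases hv : v = j
  · subst hv
    simp only [hκ, Function.update_self, Matrix.one_apply]
    congr 1
    rw [eq_comm (a := q), Equiv.swap_apply_eq_iff, Equiv.swap_apply_right]
    exact propext eq_comm
  · simp [hv]

end TensorNetworks

/-! ### Running blocks of like commands -/

section Runs

variable {V : Type*} [DecidableEq V]

lemma run_append (s : V → ZMod 2) (P Q : Pattern V) (c : Config V) :
    run s (P ++ Q) c = (run s P c).bind (run s Q) := by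
  induction P generalizing c with
  | nil => rfl
  | cons a P ih =>
    simp only [List.cons_append, run, Option.bind_assoc]
    exact congrArg _ (funext ih)

lemma run_cons_of_step {s : V → ZMod 2} {a : Cmd V} {P : Pattern V} {c c' : Config V}
    (h : step s c a = some c') : run s (a :: P) c = run s P c' := by
  rw [run, h, Option.bind_some]

lemma run_append_of_run {s : V → ZMod 2} {P Q : Pattern V} {c c' : Config V}
    (h : run s P c = some c') : run s (P ++ Q) c = run s Q c' := by
  rw [run_append, h, Option.bind_some]

/-- The entries of the operator obtained from `ρ` by preparing the qubits of `P` that are not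
in `I`, and then applying CPHASE to the edges in `F`. -/
def graphEntries (I : Finset V) (ρ : Op I) (P : Finset V) (F : Finset (V × V))
    (w : V → Fin 2 × Fin 2) : ℂ :=
  (1 / 2) ^ (P \ I).card * (∏ e ∈ F, edgeSign e.1 e.2 w)
    * ρ (fun v => (w v).1) (fun v => (w v).2)

lemma graphEntries_update {I : Finset V} (ρ : Op I) {P : Finset V} {F : Finset (V × V)} {j : V}
    (hI : j ∉ I) (hF : ∀ e ∈ F, e.1 ≠ j ∧ e.2 ≠ j) (u : V → Fin 2 × Fin 2) (q : Fin 2 × Fin 2) :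
    graphEntries I ρ P F (Function.update u j q) = graphEntries I ρ P F u := by
  have hv : ∀ v : {v // v ∈ I}, Function.update u j q v = u v := fun v =>
    Function.update_of_ne (fun h : (v : V) = j => hI (h ▸ v.2)) _ _
  simp only [graphEntries, hv]
  congr 2
  refine Finset.prod_congr rfl fun e he => ?_
  rw [edgeSign, Function.update_of_ne (hF e he).1, Function.update_of_ne (hF e he).2, edgeSign]

lemma graphEntries_insert {I : Finset V} (ρ : Op I) {P : Finset V} (F : Finset (V × V)) {j : V}
    (hI : j ∉ I) (hP : j ∉ P) :
    graphEntries I ρ (insert j P) F = fun w => 1 / 2 * graphEntries I ρ P F w := by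
  funext w
  rw [graphEntries, graphEntries, Finset.insert_sdiff_of_notMem _ hI,
    Finset.card_insert_of_notMem (by simp [hP]), pow_succ]
  ring

lemma graphEntries_insert_edge {I : Finset V} (ρ : Op I) (P : Finset V) {F : Finset (V × V)}
    {e : V × V} (he : e ∉ F) :
    graphEntries I ρ P (insert e F) = fun w => edgeSign e.1 e.2 w * graphEntries I ρ P F w := by
  funext w
  rw [graphEntries, graphEntries, Finset.prod_insert he]
  ring

variable [Fintype V]

lemma network_const_mul (κ : V → Matrix (Fin 2 × Fin 2) (Fin 2 × Fin 2) ℂ)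
    (b : (V → Fin 2 × Fin 2) → ℂ) (c : ℂ) :
    network κ (fun w => c * b w) = fun u => c * network κ b u :=
  network_mul κ b (fun _ => c) fun _ _ _ => rfl

lemma cfgOf_initial {I : Finset V} (ρ : Op I) :
    (⟨I, ∅, ρ⟩ : Config V) = cfgOf I ∅ (network 1 (graphEntries I ρ I ∅)) := by
  refine congrArg (Config.mk _ _) ?_
  ext x y
  simp [opOf, network_one, graphEntries, joinLabels]

/-- `P` contains all qubits prepared so far, including inputs and measured ones. Since nothing
outside `P` has been touched by an edge or by `κ`, a new qubit only contributes its factor 1/2. -/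
lemma run_prep (s : V → ZMod 2) {I D : Finset V} (ρ : Op I) {F : Finset (V × V)}
    {κ : V → Matrix (Fin 2 × Fin 2) (Fin 2 × Fin 2) ℂ} {l : List V} (hl : l.Nodup)
    {S P : Finset V} (hS : S ⊆ P) (hD : D ⊆ P) (hI : I ⊆ P)
    (hF : ∀ e ∈ F, e.1 ∈ P ∧ e.2 ∈ P) (hP : ∀ j ∈ l, j ∉ P) (hκ : ∀ j ∈ l, κ j = 1) :
    run s (l.map Cmd.prep) (cfgOf S D (network κ (graphEntries I ρ P F))) =
      some (cfgOf (S ∪ l.toFinset) D (network κ (graphEntries I ρ (P ∪ l.toFinset) F))) := by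
  induction l generalizing S P with
  | nil => simp [run]
  | cons j l ih =>
    obtain ⟨hjl, hl⟩ := List.nodup_cons.1 hl
    have hj : j ∉ P := hP j (by simp)
    have hjI : j ∉ I := fun h => hj (hI h)
    rw [List.map_cons, run_cons_of_step (step_prep s _ (fun h => hj (hS h)) (fun h => hj (hD h))
      (network_update (hκ j (by simp)) (graphEntries_update ρ hjI fun e he =>
        ⟨fun h => hj (h ▸ (hF e he).1), fun h => hj (h ▸ (hF e he).2)⟩))),
      ← network_const_mul, ← graphEntries_insert ρ F hjI hj,
      ih hl (Finset.insert_subset_insert j hS) (hD.trans (Finset.subset_insert _ _))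
        (hI.trans (Finset.subset_insert _ _))
        (fun e he => ⟨Finset.mem_insert_of_mem (hF e he).1, Finset.mem_insert_of_mem (hF e he).2⟩)
        (fun k hk h => (Finset.mem_insert.1 h).elim (fun h => hjl (h ▸ hk))
          (hP k (List.mem_cons_of_mem _ hk)))
        (fun k hk => hκ k (List.mem_cons_of_mem _ hk)), List.toFinset_cons,
      Finset.insert_union, Finset.insert_union, Finset.union_insert, Finset.union_insert]

lemma run_entangle (s : V → ZMod 2) {I S D P : Finset V} (ρ : Op I)
    {κ : V → Matrix (Fin 2 × Fin 2) (Fin 2 × Fin 2) ℂ} {l : List (V × V)} (hl : l.Nodup)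
    {F : Finset (V × V)} (hS : ∀ e ∈ l, e.1 ∈ S ∧ e.2 ∈ S) (hne : ∀ e ∈ l, e.1 ≠ e.2)
    (hκ : ∀ e ∈ l, κ e.1 = 1 ∧ κ e.2 = 1) (hF : ∀ e ∈ l, e ∉ F) :
    run s (l.map fun e => Cmd.entangle e.1 e.2) (cfgOf S D (network κ (graphEntries I ρ P F))) =
      some (cfgOf S D (network κ (graphEntries I ρ P (F ∪ l.toFinset)))) := by
  induction l generalizing F with
  | nil => simp [run]
  | cons e l ih =>
    obtain ⟨hel, hl⟩ := List.nodup_cons.1 hl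
    have he : e ∈ e :: l := by simp
    rw [List.map_cons, run_cons_of_step (step_entangle s _ (hS e he).1 (hS e he).2 (hne e he)),
      ← network_mul, ← graphEntries_insert_edge ρ P (hF e he),
      ih hl (fun e h => hS e (List.mem_cons_of_mem _ h))
        (fun e h => hne e (List.mem_cons_of_mem _ h))
        (fun e h => hκ e (List.mem_cons_of_mem _ h)), List.toFinset_cons, Finset.insert_union,
      Finset.union_insert]
    · intro k hk h
      exact (Finset.mem_insert.1 h).elim (fun h => hel (h ▸ hk)) (hF k (List.mem_cons_of_mem _ hk))
    · intro u w h
      rw [edgeSign, edgeSign, h _ (hκ e he).1, h _ (hκ e he).2]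

lemma run_corrZ (s : V → ZMod 2) {S D A : Finset V} (hA : A ⊆ D) (b : (V → Fin 2 × Fin 2) → ℂ)
    {l : List V} (hl : l.Nodup) (hS : ∀ k ∈ l, k ∈ S)
    (κ : V → Matrix (Fin 2 × Fin 2) (Fin 2 × Fin 2) ℂ) :
    run s (l.map fun k => Cmd.corrZ k A) (cfgOf S D (network κ b)) =
      some (cfgOf S D (network
        (fun v => if v ∈ l then conjMatrix (pauliZ ^ (signal s A).val) * κ v else κ v) b)) := by
  induction l generalizing κ with
  | nil => simp [run]
  | cons k l ih =>
    obtain ⟨hkl, hl⟩ := List.nodup_cons.1 hl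
    rw [List.map_cons, run_cons_of_step (step_corrZ s _ (hS k (by simp)) hA), siteOp_network,
      ih hl (fun e h => hS e (List.mem_cons_of_mem _ h))]
    congr 3
    funext v
    by_cases hv : v = k
    · subst hv; simp [hkl]
    · simp [hv]

end Runs

/-! ### Normal form of lazy 1WQC -/

section FlowSchemes

lemma IsFlow.xDep_lt {V : Type*} [Fintype V] [LinearOrder V] {G : SimpleGraph V} {I O : Finset V}
    {f : {v // v ∉ O} → {v // v ∉ I}} {prec : V → V → Prop} (hflow : IsFlow G I O f prec)
    (htotal : ∀ i j : V, prec i j → i < j)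
    {i k : V} (h : k ∈ xDep f i) : k ∉ O ∧ k < i := by
  simp only [xDep, Finset.mem_image, Finset.mem_filter, Finset.mem_univ, true_and] at h
  obtain ⟨j, rfl, rfl⟩ := h
  exact ⟨j.2, htotal _ _ (hflow.f1 j)⟩

variable {V : Type*} [Fintype V] [LinearOrder V] (G : SimpleGraph V) [DecidableRel G.Adj]
  {I O : Finset V} (f : {v // v ∉ O} → {v // v ∉ I}) (φ : {v // v ∉ O} → ℝ) (s : V → ZMod 2)

/-- The superoperator that both schemes apply to the qubit `v` after entangling: the measurement
with the adapted angle for `v ∉ O`, the corrections for `v ∈ O`. -/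
def finalSite (v : V) : Matrix (Fin 2 × Fin 2) (Fin 2 × Fin 2) ℂ :=
  if h : v ∉ O then
    measMatrix ((-1) ^ (signal s (xDep f v)).val * φ ⟨v, h⟩
      + (signal s (zDep G f v)).val * Real.pi + (s v).val * Real.pi)
  else pauliMatrix (signal s (xDep f v)) (signal s (zDep G f v))

/-- The edges of `G`, each of them with its smaller end first. -/
def orderedEdges : Finset (V × V) :=
  Finset.univ.filter fun e : V × V => e.1 < e.2 ∧ G.Adj e.1 e.2

variable {f} {prec : V → V → Prop}

lemma zDep_lt {i k : V} (h : k ∈ zDep G f i) : k ∉ O ∧ k < i := by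
  simp only [zDep, Finset.mem_image, Finset.mem_filter, Finset.mem_univ, true_and] at h
  obtain ⟨j, ⟨h, -⟩, rfl⟩ := h
  exact ⟨j.2, h⟩

/-- The qubits prepared by the rounds of lazy 1WQC for the vertices in `l`, including the inputs. -/
def preparedBy (I : Finset V) (l : Finset V) : Finset V := I ∪ l.biUnion (closedNbhd G)

/-- Lazy 1WQC, stopped after the rounds for the vertices in `l`. -/
lemma run_lazyRounds (hflow : IsFlow G I O f prec) (htotal : ∀ i j : V, prec i j → i < j)
    (ρ : Op I) (l r : List V) (hlr : (Finset.univ.sort (· ≤ ·) : List V) = l ++ r) :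
    run s (l.flatMap (lazyRound G f φ)) ⟨I, ∅, ρ⟩ =
      some (cfgOf (preparedBy G I l.toFinset \ (l.toFinset \ O)) (l.toFinset \ O)
        (network (fun v => if v ∈ l then finalSite G f φ s v else 1)
          (graphEntries I ρ (preparedBy G I l.toFinset)
            ((orderedEdges G).filter fun e => e.1 ∈ l)))) := by
  -- The suffix `r` is kept so that `l` is known to be an initial segment of the sorted vertices.
  induction l using List.reverseRecOn generalizing r with
  | nil =>
    rw [cfgOf_initial]
    simp [run, preparedBy]
    rfl
  | append_singleton l i ih =>
    have hsorted : (l ++ i :: r).Pairwise (· < ·) := by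
      have := Finset.sortedLT_sort (Finset.univ : Finset V)
      rw [hlr, List.append_assoc] at this
      exact this.pairwise
    have hmem : ∀ v : V, v ∈ l ∨ v = i ∨ v ∈ r := by
      intro v
      have : v ∈ (Finset.univ.sort (· ≤ ·) : List V) := by simp
      rw [hlr] at this
      simpa [or_assoc] using this
    obtain ⟨-, hr, hcross⟩ := List.pairwise_append.1 hsorted
    -- This identifies the history of the run with the index sets `j < i` in `fresh` and `zDep`.
    have hlt : ∀ v, v ∈ l ↔ v < i := by
      intro v
      refine ⟨fun h => hcross v h i (by simp), fun h => ?_⟩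
      rcases hmem v with h1 | rfl | h1
      · exact h1
      · exact absurd h (lt_irrefl _)
      · exact absurd ((List.pairwise_cons.1 hr).1 v h1) h.asymm
    have hil : i ∉ l := fun h => lt_irrefl i ((hlt i).1 h)
    set P := preparedBy G I l.toFinset with hPdef
    set M := l.toFinset \ O with hMdef
    have hself : ∀ v, v ∈ closedNbhd G v := fun v => Finset.mem_insert_self _ _
    have hsub : ∀ v ∈ l, closedNbhd G v ⊆ P := fun v hv =>
      (Finset.subset_biUnion_of_mem (closedNbhd G) (List.mem_toFinset.2 hv)).trans
        Finset.subset_union_right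
    have hIP : I ⊆ P := Finset.subset_union_left
    have hMP : M ⊆ P := fun v hv =>
      hsub v (List.mem_toFinset.1 (Finset.mem_sdiff.1 hv).1) (hself v)
    have hfilter : Finset.univ.filter (· < i) = l.toFinset := by ext v; simp [hlt]
    have hfresh : fresh G I i = closedNbhd G i \ P := by rw [fresh, hfilter, hPdef, preparedBy]
    have hP' : preparedBy G I (l ++ [i]).toFinset = P ∪ fresh G I i := by
      rw [hfresh, Finset.union_sdiff_self_eq_union, hPdef, preparedBy, preparedBy,
        List.toFinset_append, Finset.union_biUnion, Finset.union_assoc]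
      simp
    have hfreshmem : ∀ v ∈ fresh G I i, v ∉ P := fun v hv => by
      rw [hfresh] at hv; exact (Finset.mem_sdiff.1 hv).2
    have hlive : P \ M ∪ fresh G I i = (P ∪ fresh G I i) \ M := by
      rw [Finset.union_sdiff_distrib, Finset.sdiff_eq_self_of_disjoint (s := fresh G I i)]
      exact Finset.disjoint_left.2 fun v hv hM => hfreshmem v hv (hMP hM)
    have hnbhd : ∀ v ∈ closedNbhd G i, v ∈ P ∪ fresh G I i := fun v hv => by
      rw [hfresh, Finset.union_sdiff_self_eq_union]; exact Finset.mem_union_right _ hv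
    have hMlt : ∀ v ∈ M, v < i := fun v hv =>
      (hlt v).1 (List.mem_toFinset.1 (Finset.mem_sdiff.1 hv).1)
    have hdone : ∀ v, v ∉ O ∧ v < i → v ∈ M := fun v hv =>
      Finset.mem_sdiff.2 ⟨List.mem_toFinset.2 ((hlt v).2 hv.2), hv.1⟩
    have hxM : xDep f i ⊆ M := fun k hk => hdone k (hflow.xDep_lt htotal hk)
    have hzM : zDep G f i ⊆ M := fun k hk => hdone k (zDep_lt G hk)
    have hiS : i ∈ (P ∪ fresh G I i) \ M :=
      Finset.mem_sdiff.2 ⟨hnbhd i (hself i), fun h => lt_irrefl i (hMlt i h)⟩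
    set κ : V → Matrix (Fin 2 × Fin 2) (Fin 2 × Fin 2) ℂ :=
      fun v => if v ∈ l then finalSite G f φ s v else 1 with hκdef
    have hκ : ∀ v, ¬ v < i → κ v = 1 := fun v hv => if_neg fun h => hv ((hlt v).1 h)
    have hκ' : (fun v => if v ∈ l ++ [i] then finalSite G f φ s v else 1) =
        Function.update κ i (finalSite G f φ s i) := by
      funext v
      by_cases hv : v = i
      · subst hv; simp
      · simp [hv, hκdef]
    rw [List.flatMap_append, run_append_of_run (ih (i :: r) (by simpa using hlr)),
      List.flatMap_singleton, lazyRound, List.append_assoc,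
      run_append_of_run (run_prep s ρ (Finset.nodup_toList _) Finset.sdiff_subset hMP hIP
        (fun e he => ?_) (fun j hj => hfreshmem j (Finset.mem_toList.1 hj)) (fun j hj => hκ j ?_)),
      Finset.toList_toFinset, hlive]
    rotate_left
    · obtain ⟨he, hel⟩ := Finset.mem_filter.1 he
      refine ⟨hsub _ hel (hself _), hsub _ hel (Finset.mem_insert_of_mem ?_)⟩
      simpa using (Finset.mem_filter.1 he).2.2
    -- A fresh `j` below `i` would have been prepared in its own round, as `j ∈ N[j]`.
    · exact fun h => hfreshmem j (Finset.mem_toList.1 hj) (hsub j ((hlt j).2 h) (hself j))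
    have hent : ((G.neighborFinset i).filter (i < ·)).toList.map (Cmd.entangle i) =
        (((G.neighborFinset i).filter (i < ·)).toList.map (Prod.mk i)).map
          fun e => Cmd.entangle e.1 e.2 := by
      rw [List.map_map]; rfl
    have hmem_ent : ∀ e ∈ ((G.neighborFinset i).filter (i < ·)).toList.map (Prod.mk i),
        e.1 = i ∧ G.Adj i e.2 ∧ i < e.2 := by
      intro e he
      simp only [List.mem_map, Finset.mem_toList, Finset.mem_filter,
        SimpleGraph.mem_neighborFinset] at he
      obtain ⟨k, hk, rfl⟩ := he
      exact ⟨rfl, hk⟩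
    have hedges : (orderedEdges G).filter (fun e => e.1 ∈ l) ∪
        (((G.neighborFinset i).filter (i < ·)).toList.map (Prod.mk i)).toFinset =
        (orderedEdges G).filter fun e => e.1 ∈ l ++ [i] := by
      ext ⟨a, b⟩
      simp only [Finset.mem_union, Finset.mem_filter, orderedEdges, Finset.mem_univ, true_and,
        List.mem_toFinset, List.mem_map, Finset.mem_toList, SimpleGraph.mem_neighborFinset,
        Prod.mk.injEq, List.mem_append, List.mem_singleton]
      constructor
      · rintro (h | ⟨k, h, rfl, rfl⟩)
        · exact ⟨h.1, Or.inl h.2⟩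
        · exact ⟨⟨h.2, h.1⟩, Or.inr rfl⟩
      · rintro ⟨h, h' | rfl⟩
        · exact Or.inl ⟨h, h'⟩
        · exact Or.inr ⟨b, ⟨h.2, h.1⟩, rfl, rfl⟩
    rw [hent, run_append_of_run (run_entangle s ρ
      ((Finset.nodup_toList _).map (Prod.mk_right_injective i)) (fun e he => ?_) (fun e he => ?_)
      (fun e he => ?_) (fun e he => ?_)), hedges, hP', hκ']
    rotate_left
    -- The larger end of the edge is alive: it lies in `N[i]`, and all measured vertices are below
    -- `i`.
    · obtain ⟨h1, h2, h3⟩ := hmem_ent e he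
      refine ⟨h1 ▸ hiS, Finset.mem_sdiff.2 ⟨hnbhd _ (Finset.mem_insert_of_mem (by simpa using h2)),
        fun h => (hMlt _ h).asymm h3⟩⟩
    · obtain ⟨h1, h2, h3⟩ := hmem_ent e he
      exact h1 ▸ h3.ne
    · obtain ⟨h1, h2, h3⟩ := hmem_ent e he
      exact ⟨hκ _ (by rw [h1]; exact lt_irrefl i), hκ _ h3.asymm⟩
    · obtain ⟨h1, h2, h3⟩ := hmem_ent e he
      exact fun h => hil (h1 ▸ (Finset.mem_filter.1 h).2)
    by_cases hO : i ∉ O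
    · have hM' : (l ++ [i]).toFinset \ O = insert i M := by
        rw [List.toFinset_append, Finset.union_sdiff_distrib, ← hMdef, Finset.union_comm]
        simp [Finset.sdiff_eq_self_of_disjoint, hO]
      rw [dif_pos hO, run_cons_of_step (step_measure s _ _ hiS hxM hzM), run, siteOp_network,
        hκ i (lt_irrefl i), mul_one, hM', Finset.sdiff_insert, finalSite, dif_pos hO]
    · have hM' : (l ++ [i]).toFinset \ O = M := by
        rw [List.toFinset_append, Finset.union_sdiff_distrib, ← hMdef]
        simp [not_not.1 hO]
      -- `Z` is executed before `X`, which gives the factors of `pauliMatrix` in their defining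
      -- order.
      rw [dif_neg hO, run_cons_of_step (step_corrZ s _ hiS hzM), siteOp_network,
        run_cons_of_step (step_corrX s _ hiS hxM), siteOp_network, run, Function.update_idem,
        Function.update_self, hκ i (lt_irrefl i), mul_one, hM', finalSite, dif_neg hO, pauliMatrix]

end FlowSchemes

/-! ### Accumulated X corrections -/

section FlipExponents

variable {V : Type*} [DecidableEq V] {I O : Finset V} (f : {v // v ∉ O} → {v // v ∉ I})
  (s : V → ZMod 2) {prec : V → V → Prop}

/-- The exponent of the `X` correction that the measurements in `l` cause at `v`. -/
def exponentX (l : List {v // v ∉ O}) (v : V) : ZMod 2 :=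
  (l.map fun i => if (f i : V) = v then s i else 0).sum

variable {f}

/-- If `f j = i`, then `j ≺ i`, so `j` cannot come later in the list; and `f i ≠ i` by adjacency.
Thus `i` has all its `X` corrections when its turn comes. -/
lemma exponentX_append_of_pairwise {G : SimpleGraph V} (hflow : IsFlow G I O f prec)
    {l r : List {v // v ∉ O}} {i : {v // v ∉ O}}
    (h : (i :: r).Pairwise fun i j : {v // v ∉ O} => ¬ prec j i) :
    exponentX f s (l ++ i :: r) i = exponentX f s l i := by
  rw [exponentX, List.map_append, List.sum_append, List.sum_eq_zero (l := List.map _ (i :: r)),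
    add_zero, exponentX]
  intro x hx
  obtain ⟨j, hj, rfl⟩ := List.mem_map.1 hx
  refine if_neg fun hfj => ?_
  rcases List.mem_cons.1 hj with rfl | hj
  · exact (hflow.f0 j).ne hfj.symm
  · exact (List.pairwise_cons.1 h).1 j hj (hfj ▸ hflow.f1 j)

lemma exponentX_concat (l : List {v // v ∉ O}) (i : {v // v ∉ O}) (v : V) :
    exponentX f s (l ++ [i]) v = exponentX f s l v + if (f i : V) = v then s i else 0 := by
  simp [exponentX]

end FlipExponents

/-! ### Accumulated Z corrections -/

section PhaseExponents

variable {V : Type*} [DecidableEq V] (G : SimpleGraph V) [DecidableRel G.Adj] {I O : Finset V}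
  (f : {v // v ∉ O} → {v // v ∉ I}) (s : V → ZMod 2) {prec : V → V → Prop}

/-- The exponent of the `Z` correction that the measurements in `l` cause at `v`. -/
def exponentZ (l : List {v // v ∉ O}) (v : V) : ZMod 2 :=
  (l.map fun i => if G.Adj (f i) v ∧ v ≠ i then s i else 0).sum

variable {f}

/-- The last flow condition forces `j ≺ i` for each `j` whose measurement causes a `Z` at `i`, so
none of these comes later. -/
lemma exponentZ_append_of_pairwise (hflow : IsFlow G I O f prec)
    {l r : List {v // v ∉ O}} {i : {v // v ∉ O}}
    (h : (i :: r).Pairwise fun i j : {v // v ∉ O} => ¬ prec j i) :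
    exponentZ G f s (l ++ i :: r) i = exponentZ G f s l i := by
  rw [exponentZ, List.map_append, List.sum_append, List.sum_eq_zero (l := List.map _ (i :: r)),
    add_zero, exponentZ]
  intro x hx
  obtain ⟨j, hj, rfl⟩ := List.mem_map.1 hx
  refine if_neg fun hfj => ?_
  rcases List.mem_cons.1 hj with rfl | hj
  · exact hfj.2 rfl
  · exact (List.pairwise_cons.1 h).1 j hj (hflow.f2 j i hfj.1 hfj.2)

lemma exponentZ_concat (l : List {v // v ∉ O}) (i : {v // v ∉ O}) (v : V) :
    exponentZ G f s (l ++ [i]) v =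
      exponentZ G f s l v + if G.Adj (f i) v ∧ v ≠ i then s i else 0 := by
  simp [exponentZ]

end PhaseExponents

/-! ### Normal form of standard 1WQC and comparison -/

section StandardScheme

variable {V : Type*} [Fintype V] [LinearOrder V] (G : SimpleGraph V) [DecidableRel G.Adj]
  {I O : Finset V} (f : {v // v ∉ O} → {v // v ∉ I}) (φ : {v // v ∉ O} → ℝ) (s : V → ZMod 2)

variable {f} {prec : V → V → Prop}

lemma exponentX_eq_signal {L : List {v // v ∉ O}} (hnodup : L.Nodup) (hmem : ∀ i, i ∈ L) (v : V) :
    exponentX f s L v = signal s (xDep f v) := by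
  have hL : L.toFinset = Finset.univ := by ext i; simp [hmem i]
  rw [exponentX, ← List.sum_toFinset _ hnodup, hL, signal, xDep,
    Finset.sum_image Subtype.val_injective.injOn, Finset.sum_filter]

/-- Standard 1WQC excludes `v = i`, the lazy signal requires `i < v`; for neighbours of `f i` the
last flow condition makes these equivalent. -/
lemma exponentZ_eq_signal (hflow : IsFlow G I O f prec) (htotal : ∀ i j : V, prec i j → i < j)
    {L : List {v // v ∉ O}} (hnodup : L.Nodup) (hmem : ∀ i, i ∈ L) (v : V) :
    exponentZ G f s L v = signal s (zDep G f v) := by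
  have hL : L.toFinset = Finset.univ := by ext i; simp [hmem i]
  rw [exponentZ, ← List.sum_toFinset _ hnodup, hL, signal, zDep,
    Finset.sum_image Subtype.val_injective.injOn, Finset.sum_filter]
  refine Finset.sum_congr rfl fun i _ => if_congr ?_ rfl rfl
  exact ⟨fun h => ⟨htotal _ _ (hflow.f2 i v h.1 h.2), h.1⟩, fun h => ⟨h.2, h.1.ne'⟩⟩

variable (f) in
/-- The superoperator that standard 1WQC has applied to the qubit `v` after the entangling phase
and the measurements in `l`. -/
def standardSite (l : List {v // v ∉ O}) (v : V) :
    Matrix (Fin 2 × Fin 2) (Fin 2 × Fin 2) ℂ :=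
  if v ∈ l.map Subtype.val then finalSite G f φ s v
  else pauliMatrix (exponentX f s l v) (exponentZ G f s l v)

variable (f) in
/-- One measurement of standard 1WQC, followed by its corrections. -/
def standardRound (i : {v // v ∉ O}) : Pattern V :=
  Cmd.measure (i : V) (φ i) ∅ ∅
    :: (((G.neighborFinset (f i : V)).erase (i : V)).toList.map fun k => Cmd.corrZ k {(i : V)})
    ++ [Cmd.corrX (f i : V) {(i : V)}]

/-- The pending Paulis at `i` have the exponents of the whole list, because `i` and the later
measurements add nothing at `i`. The measurement with the plain angle then turns into the adapted
one. -/
lemma measMatrix_mul_standardSite (hflow : IsFlow G I O f prec)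
    (htotal : ∀ i j : V, prec i j → i < j) {l r : List {v // v ∉ O}} {i : {v // v ∉ O}}
    (hnodup : (l ++ i :: r).Nodup) (hmem : ∀ j, j ∈ l ++ i :: r)
    (horder : (l ++ i :: r).Pairwise fun i j : {v // v ∉ O} => ¬ prec j i) :
    measMatrix (φ i + (s i).val * Real.pi) * standardSite G f φ s l i = finalSite G f φ s i := by
  have hil : (i : V) ∉ l.map Subtype.val := by
    intro h
    obtain ⟨j, hj, hji⟩ := List.mem_map.1 h
    obtain rfl : j = i := Subtype.ext hji
    exact (List.nodup_append.1 hnodup).2.2 j hj j (by simp) rfl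
  have hr := (List.pairwise_append.1 horder).2.1
  rw [standardSite, if_neg hil, ← exponentX_append_of_pairwise s hflow hr,
    ← exponentZ_append_of_pairwise G s hflow hr, exponentX_eq_signal s hnodup hmem,
    exponentZ_eq_signal G s hflow htotal hnodup hmem, measMatrix_mul_pauliMatrix, finalSite,
    dif_pos i.2]

/-- Standard 1WQC after the entangling phase, stopped after the measurements in `l`. -/
lemma run_standardRounds (hflow : IsFlow G I O f prec) (htotal : ∀ i j : V, prec i j → i < j)
    (b : (V → Fin 2 × Fin 2) → ℂ) (l r : List {v // v ∉ O}) (hnodup : (l ++ r).Nodup)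
    (hmem : ∀ i, i ∈ l ++ r)
    (horder : (l ++ r).Pairwise fun i j : {v // v ∉ O} => ¬ prec j i) :
    run s (l.flatMap (standardRound G f φ)) (cfgOf Finset.univ ∅ (network 1 b)) =
      some (cfgOf (Finset.univ \ (l.map Subtype.val).toFinset) (l.map Subtype.val).toFinset
        (network (standardSite G f φ s l) b)) := by
  -- `finalSite` involves the signals of all measurements, so the hypotheses must speak of the
  -- complete list `l ++ r`, not of the prefix.
  induction l using List.reverseRecOn generalizing r with
  | nil =>
    have : standardSite G f φ s [] = 1 := by
      funext v
      simp [standardSite, exponentX, exponentZ, pauliMatrix_zero]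
    simp [run, this]
  | append_singleton l i ih =>
    rw [List.append_assoc, List.singleton_append] at hnodup hmem horder
    have hil : (i : V) ∉ l.map Subtype.val := by
      intro h
      obtain ⟨j, hj, hji⟩ := List.mem_map.1 h
      obtain rfl : j = i := Subtype.ext hji
      exact (List.nodup_append.1 hnodup).2.2 j hj j (by simp) rfl
    have hbefore : ∀ v ∈ l.map Subtype.val, ¬ prec i v := by
      intro v hv
      obtain ⟨j, hj, rfl⟩ := List.mem_map.1 hv
      exact (List.pairwise_append.1 horder).2.2 j hj i (by simp)
    set D := (l.map Subtype.val).toFinset with hD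
    -- All targets of the corrections lie above `i`, whereas no vertex measured earlier does.
    have hlive : ∀ v : V, v ≠ i → prec i v → v ∈ (Finset.univ \ D).erase (i : V) := by
      intro v hv hp
      simp only [Finset.mem_erase, Finset.mem_sdiff, Finset.mem_univ, true_and, hD,
        List.mem_toFinset]
      exact ⟨hv, fun h => hbefore v h hp⟩
    have hD' : ((l ++ [i]).map Subtype.val).toFinset = insert (i : V) D := by
      rw [List.map_append, List.toFinset_append, Finset.union_comm]; rfl
    have hsig : signal s {(i : V)} = s i := Finset.sum_singleton _ _
    have hsig0 : signal s ∅ = 0 := Finset.sum_empty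
    have hZ : ∀ k ∈ ((G.neighborFinset (f i : V)).erase (i : V)).toList, k ≠ i ∧ prec i k := by
      intro k hk
      simp only [Finset.mem_toList, Finset.mem_erase, SimpleGraph.mem_neighborFinset] at hk
      exact ⟨hk.1, hflow.f2 i k hk.2 hk.1⟩
    rw [List.flatMap_append, run_append_of_run (ih (i :: r) hnodup hmem horder),
      List.flatMap_singleton, standardRound, List.cons_append,
      run_cons_of_step (step_measure s _ _ (by simpa [hD] using hil) (Finset.empty_subset _)
        (Finset.empty_subset _)), siteOp_network, hsig0, ZMod.val_zero, pow_zero, one_mul,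
      Nat.cast_zero, zero_mul, add_zero,
      measMatrix_mul_standardSite G φ s hflow htotal hnodup hmem horder,
      run_append_of_run (run_corrZ s (Finset.singleton_subset_iff.2 (Finset.mem_insert_self _ _)) _
        (Finset.nodup_toList _) (fun k hk => hlive k (hZ k hk).1 (hZ k hk).2) _),
      run_cons_of_step (step_corrX s _ (hlive _ (hflow.f0 i).ne' (hflow.f1 i))
        (Finset.singleton_subset_iff.2 (Finset.mem_insert_self _ _))),
      siteOp_network, run, hD', Finset.sdiff_insert, hsig]
    congr 3
    funext v
    have hmem' : v ∈ (l ++ [i]).map Subtype.val ↔ v ∈ l.map Subtype.val ∨ v = i := by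
      simp only [List.map_append, List.mem_append, List.map_cons, List.map_nil,
        List.mem_singleton]
    have hnotZ : ∀ v : V, (v = i ∨ v ∈ l.map Subtype.val) →
        v ∉ ((G.neighborFinset (f i : V)).erase (i : V)).toList := by
      rintro v (rfl | hv) h
      · exact (hZ _ h).1 rfl
      · exact hbefore v hv (hZ _ h).2
    have hfl : (f i : V) ∉ l.map Subtype.val := fun h => hbefore _ h (hflow.f1 i)
    have hfi : (f i : V) ≠ i := (hflow.f0 i).ne'
    -- Measured vertices receive no correction. Among the others, `f i` gets only the `X`, not being
    -- its own neighbour, and the neighbours of `f i` get only the `Z`.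
    by_cases hv : v ∈ l.map Subtype.val ∨ v = i
    · have hvf : v ≠ f i := by
        rintro rfl
        exact hv.elim hfl hfi
      rw [Function.update_of_ne hvf, if_neg (hnotZ v hv.symm), standardSite, if_pos (hmem'.2 hv)]
      rcases hv with hv | rfl
      · rw [Function.update_of_ne (fun h : v = i => hil (h ▸ hv)), standardSite, if_pos hv]
      · rw [Function.update_self]
    · have hvl : v ∉ l.map Subtype.val := fun h => hv (Or.inl h)
      have hvi : v ≠ i := fun h => hv (Or.inr h)
      rw [standardSite, if_neg (fun h => hv (hmem'.1 h)), exponentX_concat, exponentZ_concat]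
      by_cases hvf : v = f i
      · subst hvf
        rw [Function.update_self, if_neg (by simp), Function.update_of_ne hfi, standardSite,
          if_neg hfl, conjMatrix_pauliX_mul_pauliMatrix]
        simp
      · rw [Function.update_of_ne hvf, Function.update_of_ne hvi, standardSite, if_neg hvl,
          if_neg (Ne.symm hvf), add_zero]
        by_cases hadj : G.Adj (f i) v
        · rw [if_pos (by simp [hadj, hvi]), if_pos ⟨hadj, hvi⟩, conjMatrix_pauliZ_mul_pauliMatrix]
        · rw [if_neg (by simp [hadj]), if_neg (fun h => hadj h.1), add_zero]

variable (f) in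
/-- The map that both schemes implement in the branch with outcomes `s`. -/
def branchMap : Op I →ₗ[ℂ] Op O where
  toFun ρ := opOf O (network (finalSite G f φ s) (graphEntries I ρ Finset.univ (orderedEdges G)))
  map_add' ρ ρ' := by
    ext x y
    simp [opOf, network, graphEntries, mul_add, Finset.sum_add_distrib]
  map_smul' c ρ := by
    ext x y
    simp only [opOf, network, graphEntries, Matrix.smul_apply, smul_eq_mul, RingHom.id_apply,
      Finset.mul_sum]
    exact Finset.sum_congr rfl fun w _ => by ring

lemma standardSite_eq_finalSite (hflow : IsFlow G I O f prec)
    (htotal : ∀ i j : V, prec i j → i < j) {L : List {v // v ∉ O}} (hnodup : L.Nodup)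
    (hmem : ∀ i, i ∈ L) : standardSite G f φ s L = finalSite G f φ s := by
  funext v
  by_cases hv : v ∉ O
  · rw [standardSite, if_pos (List.mem_map.2 ⟨⟨v, hv⟩, hmem _, rfl⟩)]
  · have : v ∉ L.map Subtype.val := fun h => by
      obtain ⟨j, -, rfl⟩ := List.mem_map.1 h
      exact hv j.2
    rw [standardSite, if_neg this, exponentX_eq_signal s hnodup hmem,
      exponentZ_eq_signal G s hflow htotal hnodup hmem, finalSite, dif_neg hv]

lemma run_standardPattern (hflow : IsFlow G I O f prec) (htotal : ∀ i j : V, prec i j → i < j)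
    (ρ : Op I) (L : List {v // v ∉ O}) (hnodup : L.Nodup) (hmem : ∀ i, i ∈ L)
    (horder : L.Pairwise fun i j : {v // v ∉ O} => ¬ prec j i) :
    run s (standardPattern G f φ L) ⟨I, ∅, ρ⟩ = some ⟨O, Oᶜ, branchMap G f φ s ρ⟩ := by
  have hout : (L.map Subtype.val).toFinset = Oᶜ := by
    ext v; simp [hmem]
  have hlive : Finset.univ \ Oᶜ = O := by simp
  have hcompl : I ∪ (Iᶜ).toList.toFinset = Finset.univ := by simp
  have hF : ∅ ∪ (orderedEdges G).toList.toFinset = orderedEdges G := by simp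
  have hpat : standardPattern G f φ L = (Iᶜ).toList.map Cmd.prep ++
      (((orderedEdges G).toList.map fun e => Cmd.entangle e.1 e.2) ++
        L.flatMap (standardRound G f φ)) := List.append_assoc _ _ _
  have hrun := run_standardRounds G φ s hflow htotal
    (graphEntries I ρ Finset.univ (orderedEdges G)) L [] (by simpa) (by simp [hmem]) (by simpa)
  rw [hpat, cfgOf_initial, run_append_of_run (run_prep s ρ (Finset.nodup_toList _) subset_rfl
      (Finset.empty_subset _) subset_rfl (by simp) (by simp) (by simp)), hcompl,
    run_append_of_run (run_entangle s ρ (Finset.nodup_toList _) (by simp)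
      (fun e he => (Finset.mem_filter.1 (Finset.mem_toList.1 he)).2.1.ne) (by simp) (by simp)),
    hF, hrun, hout, hlive, standardSite_eq_finalSite G φ s hflow htotal hnodup hmem]
  rfl

lemma run_lazyPattern (hflow : IsFlow G I O f prec) (htotal : ∀ i j : V, prec i j → i < j)
    (ρ : Op I) :
    run s (lazyPattern G f φ) ⟨I, ∅, ρ⟩ = some ⟨O, Oᶜ, branchMap G f φ s ρ⟩ := by
  have huniv : (Finset.univ.sort (· ≤ ·) : List V).toFinset = Finset.univ := by simp
  have hprep : preparedBy G I Finset.univ = Finset.univ := by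
    ext v
    simp only [preparedBy, Finset.mem_union, Finset.mem_biUnion, Finset.mem_univ, true_and,
      iff_true]
    exact Or.inr ⟨v, Finset.mem_insert_self _ _⟩
  have hdone : Finset.univ \ O = Oᶜ := (Finset.compl_eq_univ_sdiff O).symm
  have hlive : Finset.univ \ Oᶜ = O := by simp
  rw [lazyPattern, run_lazyRounds G φ s hflow htotal ρ _ [] (by simp), huniv, hprep, hdone, hlive]
  simp only [Finset.mem_sort, Finset.mem_univ, if_true, Finset.filter_true]
  rfl

end StandardScheme

end OneWay

end

theorem mainTheorem4 {V : Type*} [Fintype V] [LinearOrder V]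
    (G : SimpleGraph V) [DecidableRel G.Adj] (I O : Finset V)
    (f : {v // v ∉ O} → {v // v ∉ I}) (prec : V → V → Prop)
    (hflow : OneWay.IsFlow G I O f prec)
    (htotal : ∀ i j : V, prec i j → i < j)
    (φ : {v // v ∉ O} → ℝ)
    (L : List {v // v ∉ O}) (hLnodup : L.Nodup) (hLmem : ∀ i, i ∈ L)
    (hLorder : L.Pairwise fun i j : {v // v ∉ O} => ¬ prec j i) :
    ∃ K : ({v // v ∉ O} → ZMod 2) → (OneWay.Op I →ₗ[ℂ] OneWay.Op O),
      OneWay.Realizes (OneWay.lazyPattern G f φ) I O K ∧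
      OneWay.Realizes (OneWay.standardPattern G f φ L) I O K ∧
      OneWay.Implements (OneWay.lazyPattern G f φ) I O (∑ s, K s) ∧
      OneWay.Implements (OneWay.standardPattern G f φ L) I O (∑ s, K s) := by
  have hlazy : OneWay.Realizes (OneWay.lazyPattern G f φ) I O fun s =>
      OneWay.branchMap G f φ (OneWay.extendOutcomes O s) := fun s ρ =>
    OneWay.run_lazyPattern G φ _ hflow htotal ρ
  have hstandard : OneWay.Realizes (OneWay.standardPattern G f φ L) I O fun s =>
      OneWay.branchMap G f φ (OneWay.extendOutcomes O s) := fun s ρ =>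
    OneWay.run_standardPattern G φ _ hflow htotal ρ L hLnodup hLmem hLorder
  exact ⟨_, hlazy, hstandard, ⟨_, hlazy, rfl⟩, ⟨_, hstandard, rfl⟩⟩
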